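/- Let $n\ge 0$. The Novikov peakon ODEs for positions $x_1(t)<\dots<x_n(t)$ and amplitudes $m_1(t),\dots,m_n(t)\in\mathbf{R}$ (of any sign) are \[ \dot x_k=\Bigl(\sum_{i=1}^n m_i e^{-|x_k-x_i|}\Bigr)^2,\qquad \dot m_k=m_k\Bigl(\sum_{i=1}^n m_i e^{-|x_k-x_i|}\Bigr)\Bigl(\sum_{j=1}^n m_j\,\operatorname{sgn}(x_k-x_j)\,e^{-|x_k-x_j|}\Bigr), \] with $\operatorname{sgn}(0)=0$. For $x_1<\dots<x_n$ and $m_1,\dots,m_n\in\mathbf{R}$ put \[ S_k(\lambda)=\begin{pmatrix}1-\lambda m_k^2&-2\lambda m_ke^{-x_k}&-\lambda^2m_k^2e^{-2x_k}\\ m_ke^{x_k}&1&\lambda m_ke^{-x_k}\\ m_k^2e^{2x_k}&2m_ke^{x_k}&1+\lambda m_k^2\end{pmatrix}, \] let $A(\lambda)$ be the $(1,1)$ entry of the product $S_n(\lambda)\cdots S_2(\lambda)S_1(\lambda)$, and let $H_k$ be the coefficient of $(-\lambda)^k$ in the polynomial $A(\lambda)$. Let $P=\operatorname{diag}(m_1,\dots,m_n)$,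 $E=(e^{-|x_j-x_k|})_{j,k=1}^n$ and $T=(1+\operatorname{sgn}(j-k))_{j,k=1}^n$. Then: 1. $H_1,\dots,H_n$ are constants of motion: each is constant along every solution of the Novikov peakon ODEs, with $x_1<\dots<x_n$, on any time interval. 2. $A(\lambda)=\sum_{k=0}^nH_k(-\lambda)^k=\det(I-\lambda\,TPEP)$ identically in $\lambda$, and $H_0=1$. 3. The matrix $PEP=(m_jm_ke^{-|x_j-x_k|})_{j,k=1}^n$ is symmetric, and for $1\le k\le n$ the constant of motion $H_k$ equals the sum $\sum_{I,J}\det\bigl((PEP)_{IJ}\bigr)$ of all $k\times k$ minors (principal and non-principal) of $PEP$, where $I,J$ run independently over the $k$-element subsets of $\{1,\dots,n\}$, rows and columns being taken in increasing order. -/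

import Mathlib

open Matrix Polynomial

noncomputable section

namespace NovikovPeakon

/-- The peakon wave profile `u(ξ) = ∑ i, m_i e^{-|ξ - x_i|}`. -/
def wave {n : ℕ} (x m : Fin n → ℝ) (ξ : ℝ) : ℝ :=
  ∑ i, m i * Real.exp (-|ξ - x i|)

/-- The average of the two one-sided limits of `u_x` at `ξ`:
`⟨u_x(ξ)⟩ = -∑ j, m_j sgn(ξ - x_j) e^{-|ξ - x_j|}`, where `sgn 0 = 0`. -/
def waveSlopeAvg {n : ℕ} (x m : Fin n → ℝ) (ξ : ℝ) : ℝ :=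
  -∑ j, m j * Real.sign (ξ - x j) * Real.exp (-|ξ - x j|)

/-- `t ↦ (x(t), m(t))` solves the Novikov peakon equations
`x_k' = u(x_k)²`, `m_k' = -m_k u(x_k) ⟨u_x(x_k)⟩` on the time set `J`, with the peakons numbered
from left to right: `x_1 < ⋯ < x_n`. The amplitudes `m_k` may have any sign. -/
structure IsSolutionOn {n : ℕ} (x m : ℝ → Fin n → ℝ) (J : Set ℝ) : Prop where
  ordered : ∀ t ∈ J, StrictMono (x t)
  position : ∀ t ∈ J, ∀ k,
    HasDerivWithinAt (fun s => x s k) (wave (x t) (m t) (x t k) ^ 2) J t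
  momentum : ∀ t ∈ J, ∀ k,
    HasDerivWithinAt (fun s => m s k)
      (-(m t k) * wave (x t) (m t) (x t k) * waveSlopeAvg (x t) (m t) (x t k)) J t

/-- A function of positions and amplitudes is a constant of motion if it is constant along every
solution of the peakon equations, on every time interval (open or not, bounded or not). -/
def IsConstantOfMotion {n : ℕ} (F : (Fin n → ℝ) → (Fin n → ℝ) → ℝ) : Prop :=
  ∀ (J : Set ℝ), J.OrdConnected → ∀ (x m : ℝ → Fin n → ℝ), IsSolutionOn x m J →
    ∀ s ∈ J, ∀ t ∈ J, F (x s) (m s) = F (x t) (m t)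

/-- The jump matrix `S(λ)` of one peakon at position `ξ` with amplitude `μ`; its entries are
polynomials in the spectral parameter `λ`, written `X`. -/
def jumpMatrix (ξ μ : ℝ) : Matrix (Fin 3) (Fin 3) ℝ[X] :=
  !![1 - C (μ ^ 2) * X, -C (2 * μ * Real.exp (-ξ)) * X, -C (μ ^ 2 * Real.exp (-2 * ξ)) * X ^ 2;
     C (μ * Real.exp ξ), 1, C (μ * Real.exp (-ξ)) * X;
     C (μ ^ 2 * Real.exp (2 * ξ)), C (2 * μ * Real.exp ξ), 1 + C (μ ^ 2) * X]

/-- The total jump matrix `S_n(λ) ⋯ S_2(λ) S_1(λ)`. -/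
def totalJumpMatrix {n : ℕ} (x m : Fin n → ℝ) : Matrix (Fin 3) (Fin 3) ℝ[X] :=
  (List.ofFn fun k => jumpMatrix (x k) (m k)).reverse.prod

/-- `A(λ)`, the `(1,1)` entry of the total jump matrix. -/
def polyA {n : ℕ} (x m : Fin n → ℝ) : ℝ[X] :=
  totalJumpMatrix x m 0 0

/-- `H_k`, the coefficient of `(-λ)^k` in `A(λ)`. -/
def H {n : ℕ} (k : ℕ) (x m : Fin n → ℝ) : ℝ :=
  (-1) ^ k * (polyA x m).coeff k

/-- `P = diag(m_1, …, m_n)`. -/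
def matP {n : ℕ} (m : Fin n → ℝ) : Matrix (Fin n) (Fin n) ℝ :=
  Matrix.diagonal m

/-- `E_{jk} = e^{-|x_j - x_k|}`. -/
def matE {n : ℕ} (x : Fin n → ℝ) : Matrix (Fin n) (Fin n) ℝ :=
  Matrix.of fun j k => Real.exp (-|x j - x k|)

/-- `T_{jk} = 1 + sgn(j - k)`: `1` on the diagonal, `2` below it, `0` above it. -/
def matT (n : ℕ) : Matrix (Fin n) (Fin n) ℝ :=
  Matrix.of fun j k => 1 + Real.sign ((j : ℝ) - (k : ℝ))

/-- The sum of all `k × k` minors `det X_{IJ}` of `X`, principal and non-principal: `I` and `J`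
run independently over the `k`-element index sets, each listed in increasing order. -/
def sumMinors {n : ℕ} (k : ℕ) (X : Matrix (Fin n) (Fin n) ℝ) : ℝ :=
  ∑ I : {I : Finset (Fin n) // I.card = k}, ∑ J : {J : Finset (Fin n) // J.card = k},
    (X.submatrix (I.1.orderEmbOfFin I.2) (J.1.orderEmbOfFin J.2)).det

end NovikovPeakon

end

/-! ### Adding one peakon on the right: recursion for the first column. -/

namespace NovikovPeakon

/-! Everything rests on induction by adding the rightmost peakon. Left multiplication by its jump
matrix gives a closed recursion for the first column (A, B, C) of the product (`polyA_succ`,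
`polyB_succ`, `polyC_succ`), so A is studied together with B and C. Put u_i = m_i e^{x_i}, κ = m_n
e^{-x_n} and ν = m_n e^{x_n}. Because the positions are ordered, the new row and column of PEP are
κu, with corner κν = m_n².

Conservation: right of x_n the wave has the form b e^{-ξ} + a e^ξ, and (A, B, C) satisfies a linear
ODE whose coefficients depend on a, b and λ only (`hasDerivWithinAt_polyABC`). With nothing further
to the right, a = 0 and A' = 0. This holds for every λ ≠ 0, which fixes all coefficients.

Determinant: B and C are linear functionals of vectors solving (I - λTPEP) y = A T u. Since T is
lower triangular, these vectors merely gain one entry when a peakon is added, and a Cramer argument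
yields the new determinant (`exists_mulVec_eq_and_det_eq_polyA`).

Minors: up to sign, the coefficients of A, B and λC are sums of minors of PEP, plain, bordered by u
on one side, and bordered by u on both sides with corner 0. The new row is κ times the border row on
all peakon columns, so row operations give these sums the recursion of (A, B, λC) (`coeff_polyABC`).
-/

theorem totalJumpMatrix_zero (x m : Fin 0 → ℝ) : totalJumpMatrix x m = 1 := by
  simp [totalJumpMatrix]

theorem totalJumpMatrix_succ {n : ℕ} (x m : Fin (n + 1) → ℝ) :
    totalJumpMatrix x m =
      jumpMatrix (x (Fin.last n)) (m (Fin.last n)) *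
        totalJumpMatrix (fun i => x i.castSucc) (fun i => m i.castSucc) := by
  simp only [totalJumpMatrix, List.ofFn_succ', List.concat_eq_append,
    List.reverse_append, List.reverse_singleton, List.singleton_append, List.prod_cons]

/-- The second entry `B(λ)` of the first column of the total jump matrix. -/
noncomputable def polyB {n : ℕ} (x m : Fin n → ℝ) : ℝ[X] := totalJumpMatrix x m 1 0

/-- The third entry `C(λ)` of the first column of the total jump matrix. -/
noncomputable def polyC {n : ℕ} (x m : Fin n → ℝ) : ℝ[X] := totalJumpMatrix x m 2 0

@[simp] theorem polyA_zero (x m : Fin 0 → ℝ) : polyA x m = 1 := by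
  simp [polyA, totalJumpMatrix_zero]

@[simp] theorem polyB_zero (x m : Fin 0 → ℝ) : polyB x m = 0 := by
  simp [polyB, totalJumpMatrix_zero]

@[simp] theorem polyC_zero (x m : Fin 0 → ℝ) : polyC x m = 0 := by
  simp [polyC, totalJumpMatrix_zero]

section Recursion

variable {n : ℕ} (x m : Fin (n + 1) → ℝ)

theorem polyA_succ :
    polyA x m =
      (1 - C (m (Fin.last n) ^ 2) * X) * polyA (fun i => x i.castSucc) (fun i => m i.castSucc)
      - C (2 * m (Fin.last n) * Real.exp (-x (Fin.last n))) * X *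
          polyB (fun i => x i.castSucc) (fun i => m i.castSucc)
      - C (m (Fin.last n) ^ 2 * Real.exp (-2 * x (Fin.last n))) * X ^ 2 *
          polyC (fun i => x i.castSucc) (fun i => m i.castSucc) := by
  simp only [polyA, polyB, polyC, totalJumpMatrix_succ, Matrix.mul_apply, Fin.sum_univ_three,
    jumpMatrix, Matrix.of_apply, Matrix.cons_val]
  ring

theorem polyB_succ :
    polyB x m =
      C (m (Fin.last n) * Real.exp (x (Fin.last n))) *
          polyA (fun i => x i.castSucc) (fun i => m i.castSucc)
      + polyB (fun i => x i.castSucc) (fun i => m i.castSucc)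
      + C (m (Fin.last n) * Real.exp (-x (Fin.last n))) * X *
          polyC (fun i => x i.castSucc) (fun i => m i.castSucc) := by
  simp only [polyA, polyB, polyC, totalJumpMatrix_succ, Matrix.mul_apply, Fin.sum_univ_three,
    jumpMatrix, Matrix.of_apply, Matrix.cons_val]
  ring

theorem polyC_succ :
    polyC x m =
      C (m (Fin.last n) ^ 2 * Real.exp (2 * x (Fin.last n))) *
          polyA (fun i => x i.castSucc) (fun i => m i.castSucc)
      + C (2 * m (Fin.last n) * Real.exp (x (Fin.last n))) *
          polyB (fun i => x i.castSucc) (fun i => m i.castSucc)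
      + (1 + C (m (Fin.last n) ^ 2) * X) *
          polyC (fun i => x i.castSucc) (fun i => m i.castSucc) := by
  simp only [polyA, polyB, polyC, totalJumpMatrix_succ, Matrix.mul_apply, Fin.sum_univ_three,
    jumpMatrix, Matrix.of_apply, Matrix.cons_val]

end Recursion

theorem eval_zero_polyA {n : ℕ} (x m : Fin n → ℝ) : (polyA x m).eval 0 = 1 := by
  induction n with
  | zero => simp
  | succ n ih => simp [polyA_succ, ih]

theorem polyA_ne_zero {n : ℕ} (x m : Fin n → ℝ) : polyA x m ≠ 0 := by
  intro h
  simpa [h] using eval_zero_polyA x m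

/-! ### The determinant formula for A. -/

/-- If `M w` vanishes off the last coordinate, the last entries of `w` and `M w` relate `det M` to
the leading principal minor of `M`. -/
theorem _root_.Matrix.det_mul_last_of_mulVec_eq_zero {R : Type*} [CommRing R] {n : ℕ}
    (M : Matrix (Fin (n + 1)) (Fin (n + 1)) R) (w : Fin (n + 1) → R)
    (h : ∀ i : Fin n, (M *ᵥ w) i.castSucc = 0) :
    M.det * w (Fin.last n) =
      (M *ᵥ w) (Fin.last n) * (M.submatrix Fin.castSucc Fin.castSucc).det := by
  have h1 : M.cramer (M *ᵥ w) (Fin.last n) = M.det * w (Fin.last n) := by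
    rw [cramer_eq_adjugate_mulVec, mulVec_mulVec, adjugate_mul, smul_mulVec, one_mulVec,
      Pi.smul_apply, smul_eq_mul]
  -- Once the last column is replaced by `M *ᵥ w`, only its corner entry can be nonzero.
  rw [← h1, cramer_apply, det_succ_column _ (Fin.last n), Fin.sum_univ_castSucc]
  simp only [updateCol_self, h, mul_zero, zero_mul, Finset.sum_const_zero, zero_add,
    ← two_mul, pow_mul, Fin.succAbove_last, neg_one_sq, one_pow, one_mul]
  congr 2
  ext i j
  simp [(Fin.castSucc_lt_last j).ne]

theorem matPEP_apply {n : ℕ} (x m : Fin n → ℝ) (i j : Fin n) :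
    (matP m * matE x * matP m) i j = m i * m j * Real.exp (-|x i - x j|) := by
  simp [matP, matE, Matrix.mul_diagonal, Matrix.diagonal_mul]
  ring

theorem matPEP_isSymm {n : ℕ} (x m : Fin n → ℝ) : (matP m * matE x * matP m).IsSymm := by
  refine Matrix.IsSymm.ext fun i j => ?_
  rw [matPEP_apply, matPEP_apply, abs_sub_comm]
  ring

section
variable {n : ℕ} {x : Fin (n + 1) → ℝ} (m : Fin (n + 1) → ℝ)

theorem matPEP_castSucc_castSucc (i j : Fin n) :
    (matP m * matE x * matP m) i.castSucc j.castSucc =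
      (matP (fun i => m i.castSucc) * matE (fun i => x i.castSucc) *
        matP (fun i => m i.castSucc)) i j := by
  rw [matPEP_apply, matPEP_apply]

theorem matPEP_castSucc_last (hx : StrictMono x) (i : Fin n) :
    (matP m * matE x * matP m) i.castSucc (Fin.last n) =
      m (Fin.last n) * Real.exp (-x (Fin.last n)) * (m i.castSucc * Real.exp (x i.castSucc)) := by
  rw [matPEP_apply, abs_of_neg (sub_neg.2 (hx (Fin.castSucc_lt_last i))), neg_neg, sub_eq_add_neg,
    Real.exp_add]
  ring

theorem matPEP_last_castSucc (hx : StrictMono x) (i : Fin n) :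
    (matP m * matE x * matP m) (Fin.last n) i.castSucc =
      m (Fin.last n) * Real.exp (-x (Fin.last n)) * (m i.castSucc * Real.exp (x i.castSucc)) := by
  rw [← matPEP_castSucc_last m hx, (matPEP_isSymm x m).apply]

theorem matPEP_last_last :
    (matP m * matE x * matP m) (Fin.last n) (Fin.last n) = m (Fin.last n) ^ 2 := by
  rw [matPEP_apply]
  simp [pow_two]

end

@[simp] theorem matT_castSucc_castSucc {n : ℕ} (i j : Fin n) :
    matT (n + 1) i.castSucc j.castSucc = matT n i j := by
  simp [matT]

@[simp] theorem matT_castSucc_last {n : ℕ} (i : Fin n) :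
    matT (n + 1) i.castSucc (Fin.last n) = 0 := by
  simp [matT, Real.sign_of_neg]

@[simp] theorem matT_last_castSucc {n : ℕ} (i : Fin n) :
    matT (n + 1) (Fin.last n) i.castSucc = 2 := by
  have : Real.sign ((n : ℝ) - (i : ℕ)) = 1 := Real.sign_of_pos (by simp)
  simp [matT, this]
  norm_num

@[simp] theorem matT_last_last {n : ℕ} :
    matT (n + 1) (Fin.last n) (Fin.last n) = 1 := by
  simp [matT]

/-- The vector `u_i = m_i e^{x_i}`, with entries viewed as constant polynomials. -/
noncomputable def expVec {n : ℕ} (x m : Fin n → ℝ) (i : Fin n) : ℝ[X] := C (m i * Real.exp (x i))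

/-- `P E P` with entries viewed as constant polynomials. -/
noncomputable def polyPEP {n : ℕ} (x m : Fin n → ℝ) : Matrix (Fin n) (Fin n) ℝ[X] :=
  (matP m * matE x * matP m).map C

/-- `T` with entries viewed as constant polynomials. -/
noncomputable def polyT (n : ℕ) : Matrix (Fin n) (Fin n) ℝ[X] := (matT n).map C

/-- The entries of the first column of the total jump matrix in terms of the linear system
`(I - λ T P E P) y = A(λ) T u` with `u_i = m_i e^{x_i}`. -/
theorem exists_mulVec_eq_and_det_eq_polyA {n : ℕ} (x m : Fin n → ℝ) (hx : StrictMono x) :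
    ∃ y v : Fin n → ℝ[X],
      (∀ i, v i = polyA x m * expVec x m i + X * ∑ j, polyPEP x m i j * y j) ∧
      (∀ i, y i = ∑ j, polyT n i j * v j) ∧
      polyB x m = ∑ i, v i ∧
      polyC x m = ∑ i, expVec x m i * y i ∧
      polyA x m = (1 - (X : ℝ[X]) • (polyT n * polyPEP x m)).det := by
  induction n with
  | zero => exact ⟨Fin.elim0, Fin.elim0, by simp⟩
  | succ n ih =>
    obtain ⟨y, v, hv, hy, hB, hC, hA⟩ := ih (fun i => x i.castSucc) (fun i => m i.castSucc)
      (fun i j h => hx (Fin.castSucc_lt_castSucc_iff.2 h))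
    have hA0 := polyA_ne_zero (fun i => x i.castSucc) (fun i => m i.castSucc)
    have hcc := fun i j => matPEP_castSucc_castSucc (x := x) m i j
    have hcl := fun i => matPEP_castSucc_last m hx i
    have hlc := fun i => matPEP_last_castSucc m hx i
    have hll := matPEP_last_last (x := x) m
    have hA' := polyA_succ x m
    have hB' := polyB_succ x m
    have hC' := polyC_succ x m
    set A := polyA (fun i => x i.castSucc) (fun i => m i.castSucc)
    set B := polyB (fun i => x i.castSucc) (fun i => m i.castSucc)
    set D := polyC (fun i => x i.castSucc) (fun i => m i.castSucc)
    -- With κ and ν opaque, every entry of the new jump matrix is a polynomial in κ, ν and `X`.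
    obtain ⟨κ, hκ⟩ : ∃ κ : ℝ[X], κ = C (m (Fin.last n) * Real.exp (-x (Fin.last n))) := ⟨_, rfl⟩
    obtain ⟨ν, hν⟩ : ∃ ν : ℝ[X], ν = C (m (Fin.last n) * Real.exp (x (Fin.last n))) := ⟨_, rfl⟩
    have hsq : C (m (Fin.last n) ^ 2) = κ * ν := by
      rw [hκ, hν, ← C_mul, Real.exp_neg]
      congr 1
      field_simp
    have hκ2 : C (2 * m (Fin.last n) * Real.exp (-x (Fin.last n))) = 2 * κ := by
      rw [hκ, mul_assoc, C_mul]; rfl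
    have hν2 : C (2 * m (Fin.last n) * Real.exp (x (Fin.last n))) = 2 * ν := by
      rw [hν, mul_assoc, C_mul]; rfl
    have hκκ : C (m (Fin.last n) ^ 2 * Real.exp (-2 * x (Fin.last n))) = κ ^ 2 := by
      rw [hκ, ← C_pow, mul_pow, ← Real.exp_nat_mul]; push_cast; ring_nf
    have hνν : C (m (Fin.last n) ^ 2 * Real.exp (2 * x (Fin.last n))) = ν ^ 2 := by
      rw [hν, ← C_pow, mul_pow, ← Real.exp_nat_mul]; push_cast; rfl
    rw [hsq, hκ2, hκκ] at hA'
    rw [← hκ, ← hν] at hB'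
    rw [hνν, hν2, hsq] at hC'
    have hcc' : ∀ i j, polyPEP x m (Fin.castSucc i) (Fin.castSucc j) =
        polyPEP (fun i => x i.castSucc) (fun i => m i.castSucc) i j := fun i j => by
      rw [polyPEP, map_apply, hcc]; rfl
    have hcl' : ∀ i, polyPEP x m (Fin.castSucc i) (Fin.last n) =
        κ * expVec (fun i => x i.castSucc) (fun i => m i.castSucc) i := fun i => by
      rw [polyPEP, map_apply, hcl, C_mul, hκ]; rfl
    have hlc' : ∀ i, polyPEP x m (Fin.last n) (Fin.castSucc i) =
        κ * expVec (fun i => x i.castSucc) (fun i => m i.castSucc) i := fun i => by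
      rw [polyPEP, map_apply, hlc, C_mul, hκ]; rfl
    have hll' : polyPEP x m (Fin.last n) (Fin.last n) = κ * ν := by
      rw [polyPEP, map_apply, hll, hsq]
    have huc : ∀ i : Fin n, expVec x m i.castSucc =
        expVec (fun i => x i.castSucc) (fun i => m i.castSucc) i := fun i => rfl
    have hul : expVec x m (Fin.last n) = ν := hν.symm
    have tcc : ∀ i j : Fin n, polyT (n + 1) i.castSucc j.castSucc = polyT n i j := fun i j => by
      simp [polyT]
    have tcl : ∀ i : Fin n, polyT (n + 1) i.castSucc (Fin.last n) = 0 := fun i => by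
      simp [polyT]
    have tlc : ∀ i : Fin n, polyT (n + 1) (Fin.last n) i.castSucc = 2 := fun i => by
      simp only [polyT, map_apply, matT_last_castSucc]; rfl
    have tll : polyT (n + 1) (Fin.last n) (Fin.last n) = 1 := by simp [polyT]
    generalize expVec (fun i => x i.castSucc) (fun i => m i.castSucc) = u at *
    generalize polyPEP (fun i => x i.castSucc) (fun i => m i.castSucc) = Q at *
    -- E is the new entry of y. The recursion reads A' = A - λκE, so in the old equations the change
    -- of A u is cancelled by the new term λκE u, and the old y and v survive unchanged.
    obtain ⟨E, hE⟩ : ∃ E, E = ν * A + 2 * B + X * κ * D := ⟨_, rfl⟩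
    have hlast : ∀ i, ∑ j, polyPEP x m i j * (Fin.snoc y E : Fin (n + 1) → ℝ[X]) j =
        (∑ j : Fin n, polyPEP x m i j.castSucc * y j) + polyPEP x m i (Fin.last n) * E := fun i => by
      simp [Fin.sum_univ_castSucc]
    refine ⟨Fin.snoc y E, Fin.snoc v (E - 2 * B), ?_, ?_, ?_, ?_, ?_⟩
    · intro i
      rw [hlast]
      refine Fin.lastCases ?_ (fun i => ?_) i
      · simp only [hlc', hll', hul, Fin.snoc_last, mul_assoc, ← Finset.mul_sum, ← hC]
        rw [hA', hE]
        ring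
      · simp only [hcc', hcl', huc, Fin.snoc_castSucc, hv]
        rw [hA', hE]
        ring
    · intro i
      rw [Fin.sum_univ_castSucc]
      refine Fin.lastCases ?_ (fun i => ?_) i
      · simp only [tlc, tll, Fin.snoc_last, Fin.snoc_castSucc, ← Finset.mul_sum, ← hB]
        ring
      · simp only [tcc, tcl, Fin.snoc_castSucc, hy]
        ring
    · simp only [Fin.sum_univ_castSucc, Fin.snoc_last, Fin.snoc_castSucc, ← hB]
      rw [hB', hE]
      ring
    · simp only [Fin.sum_univ_castSucc, Fin.snoc_last, Fin.snoc_castSucc, huc, hul, ← hC]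
      rw [hC', hE]
      ring
    · have hmul : ∀ w : Fin (n + 1) → ℝ[X],
          (1 - (X : ℝ[X]) • (polyT (n + 1) * polyPEP x m)) *ᵥ w =
            w - X • (polyT (n + 1) *ᵥ (polyPEP x m *ᵥ w)) := fun w => by
        rw [sub_mulVec, one_mulVec, smul_mulVec, mulVec_mulVec]
      -- Chosen so that (I - λTPEP) w has zero old entries and last entry A'. The minor lemma then
      -- gives det · A = A' · A, and A ≠ 0 cancels.
      obtain ⟨w, hw⟩ : ∃ w : Fin (n + 1) → ℝ[X], w = Fin.snoc (fun i => X * κ * y i) A := ⟨_, rfl⟩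
      have hwc : ∀ i : Fin n, w i.castSucc = X * κ * y i := fun i => by simp [hw]
      have hwl : w (Fin.last n) = A := by simp [hw]
      have hqc : ∀ i : Fin n, (polyPEP x m *ᵥ w) i.castSucc = κ * v i := fun i => by
        simp only [mulVec, dotProduct, Fin.sum_univ_castSucc, hwc, hwl, hcc', hcl', hv,
          mul_left_comm (Q i _), ← Finset.mul_sum]
        ring
      have hql : (polyPEP x m *ᵥ w) (Fin.last n) = X * κ ^ 2 * D + κ * ν * A := by
        simp only [mulVec, dotProduct, Fin.sum_univ_castSucc, hwc, hwl, hlc', hll', hC,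
          Finset.mul_sum]
        congr 1
        exact Finset.sum_congr rfl fun i _ => by ring
      have h0 : ∀ i : Fin n,
          ((1 - (X : ℝ[X]) • (polyT (n + 1) * polyPEP x m)) *ᵥ w) i.castSucc = 0 := fun i => by
        rw [hmul, Pi.sub_apply, Pi.smul_apply, hwc, mulVec, dotProduct, Fin.sum_univ_castSucc]
        simp only [hqc, tcc, tcl, hy, mul_left_comm (polyT n i _), ← Finset.mul_sum, smul_eq_mul]
        ring
      have h1 : ((1 - (X : ℝ[X]) • (polyT (n + 1) * polyPEP x m)) *ᵥ w) (Fin.last n) =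
          polyA x m := by
        rw [hmul, Pi.sub_apply, Pi.smul_apply, hwl, mulVec, dotProduct, Fin.sum_univ_castSucc]
        simp only [hqc, hql, tlc, tll, mul_left_comm (2 : ℝ[X]), ← Finset.mul_sum, ← hB, hA',
          smul_eq_mul]
        ring
      have h2 : (1 - (X : ℝ[X]) • (polyT (n + 1) * polyPEP x m)).submatrix Fin.castSucc
          Fin.castSucc = 1 - (X : ℝ[X]) • (polyT n * Q) := by
        ext1 i j
        simp [Matrix.one_apply, Matrix.mul_apply, Fin.sum_univ_castSucc, tcc, tcl, hcc']
      have h3 := Matrix.det_mul_last_of_mulVec_eq_zero _ w h0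
      rw [h1, hwl, h2, ← hA] at h3
      exact (mul_right_cancel₀ hA0 h3).symm

theorem polyA_eq_det {n : ℕ} (x m : Fin n → ℝ) (hx : StrictMono x) :
    polyA x m = (1 - (X : ℝ[X]) • (matT n * matP m * matE x * matP m).map C).det := by
  obtain ⟨-, -, -, -, -, -, h⟩ := exists_mulVec_eq_and_det_eq_polyA x m hx
  rw [h, polyT, polyPEP, ← Matrix.map_mul, Matrix.mul_assoc, Matrix.mul_assoc, Matrix.mul_assoc]

/-! ### Sums over increasing index tuples. -/

section SumIncr

open Classical in
/-- The strictly increasing `k`-tuples of indices in `Fin n`. -/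
noncomputable def incr (k n : ℕ) : Finset (Fin k → Fin n) := Finset.univ.filter StrictMono

theorem mem_incr {k n : ℕ} {f : Fin k → Fin n} : f ∈ incr k n ↔ StrictMono f := by
  simp [incr]

variable {ι R : Type*} [CommRing R]

/-- The sum of `φ` over the length-`k` subsequences of the finite sequence `a`. -/
noncomputable def sumIncr {n : ℕ} (k : ℕ) (a : Fin n → ι) (φ : (Fin k → ι) → R) : R :=
  ∑ f ∈ incr k n, φ fun i => a (f i)

theorem sumIncr_zero {n : ℕ} (a : Fin n → ι) (φ : (Fin 0 → ι) → R) :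
    sumIncr 0 a φ = φ Fin.elim0 := by
  have : incr 0 n = {Fin.elim0} := by
    ext f
    simp only [mem_incr, Finset.mem_singleton, Subsingleton.elim f Fin.elim0, iff_true]
    exact fun i => i.elim0
  rw [sumIncr, this, Finset.sum_singleton]
  exact congrArg φ (Subsingleton.elim _ _)

theorem sumIncr_succ_of_isEmpty (k : ℕ) (a : Fin 0 → ι) (φ : (Fin (k + 1) → ι) → R) :
    sumIncr (k + 1) a φ = 0 :=
  Finset.sum_eq_zero fun f _ => (f 0).elim0

/-- An increasing tuple can meet the largest index only in its last place, so the tuples split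
according to whether they end there. -/
theorem sumIncr_succ {n : ℕ} (k : ℕ) (a : Fin (n + 1) → ι) (φ : (Fin (k + 1) → ι) → R) :
    sumIncr (k + 1) a φ = sumIncr (k + 1) (fun i => a i.castSucc) φ +
      sumIncr k (fun i => a i.castSucc)
        (fun f => φ (Fin.snoc (α := fun _ => ι) f (a (Fin.last n)))) := by
  rw [sumIncr, ← Finset.sum_filter_add_sum_filter_not _ (fun f => f (Fin.last k) ≠ Fin.last n)]
  congr 1
  · symm
    refine Finset.sum_bij (fun f _ i => (f i).castSucc) (fun f hf => ?_) (fun f _ g _ h => ?_)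
      (fun f hf => ?_) (fun f _ => rfl)
    · rw [mem_incr] at hf
      rw [Finset.mem_filter, mem_incr]
      exact ⟨fun i j hij => Fin.castSucc_lt_castSucc_iff.2 (hf hij), (Fin.castSucc_lt_last _).ne⟩
    · exact funext fun i => Fin.castSucc_injective _ (congrFun h i)
    · rw [Finset.mem_filter, mem_incr] at hf
      have h : ∀ i, f i ≠ Fin.last n := fun i =>
        ((hf.1.monotone (Fin.le_last i)).trans_lt (Fin.lt_last_iff_ne_last.2 hf.2)).ne
      refine ⟨fun i => (f i).castPred (h i), ?_, by simp⟩
      rw [mem_incr]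
      exact fun i j hij => by simpa using hf.1 hij
  · symm
    refine Finset.sum_bij
      (fun f _ => Fin.snoc (α := fun _ => Fin (n + 1)) (fun i => (f i).castSucc) (Fin.last n))
      (fun f hf => ?_) (fun f _ g _ h => ?_) (fun f hf => ?_) (fun f _ => ?_)
    · rw [mem_incr] at hf
      rw [Finset.mem_filter, mem_incr]
      refine ⟨fun i j => ?_, by simp⟩
      refine Fin.lastCases (fun h => absurd h (Fin.le_last j).not_gt) (fun i => ?_) i
      refine Fin.lastCases (fun _ => ?_) (fun j hij => ?_) j
      · simp [Fin.castSucc_lt_last]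
      · simpa using hf (by simpa using hij)
    · exact funext fun i => by simpa using congrFun h i.castSucc
    · rw [Finset.mem_filter, mem_incr, not_not] at hf
      have h : ∀ i : Fin k, f i.castSucc ≠ Fin.last n := fun i =>
        ((hf.1 (Fin.castSucc_lt_last i)).trans_eq hf.2).ne
      refine ⟨fun i => (f i.castSucc).castPred (h i), ?_, ?_⟩
      · rw [mem_incr]
        exact fun i j hij => by simpa using hf.1 (Fin.castSucc_lt_castSucc_iff.2 hij)
      · funext i
        refine Fin.lastCases ?_ (fun i => ?_) i
        · simp [hf.2]
        · simp
    · refine congrArg φ (funext fun i => ?_)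
      refine Fin.lastCases ?_ (fun i => ?_) i
      · simp
      · simp

theorem sumIncr_add {n k : ℕ} (a : Fin n → ι) (φ ψ : (Fin k → ι) → R) :
    sumIncr k a (fun f => φ f + ψ f) = sumIncr k a φ + sumIncr k a ψ :=
  Finset.sum_add_distrib

theorem sumIncr_mul {n k : ℕ} (a : Fin n → ι) (c : R) (φ : (Fin k → ι) → R) :
    sumIncr k a (fun f => c * φ f) = c * sumIncr k a φ :=
  (Finset.mul_sum _ _ _).symm

theorem sumIncr_eq_zero {n k : ℕ} (a : Fin n → ι) : sumIncr k a (fun _ => (0 : R)) = 0 :=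
  Finset.sum_const_zero

theorem sumIncr_congr {n k : ℕ} {a : Fin n → ι} {φ ψ : (Fin k → ι) → R}
    (h : ∀ f : Fin k → Fin n, φ (fun i => a (f i)) = ψ (fun i => a (f i))) :
    sumIncr k a φ = sumIncr k a ψ :=
  Finset.sum_congr rfl fun f _ => h f

theorem sumIncr_comm {n k l : ℕ} (a : Fin n → ι) (φ : (Fin k → ι) → (Fin l → ι) → R) :
    sumIncr k a (fun f => sumIncr l a (fun g => φ f g)) =
      sumIncr l a (fun g => sumIncr k a (fun f => φ f g)) :=
  Finset.sum_comm

theorem sumMinors_eq_sumIncr {n : ℕ} (k : ℕ) (X : Matrix (Fin n) (Fin n) ℝ) :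
    sumMinors k X = sumIncr k id fun f => sumIncr k id fun g => (X.submatrix f g).det := by
  have key : ∀ φ : (Fin k → Fin n) → ℝ,
      ∑ I : {I : Finset (Fin n) // I.card = k}, φ (I.1.orderEmbOfFin I.2) =
        sumIncr k id φ := by
    intro φ
    refine Finset.sum_bij (fun I _ => I.1.orderEmbOfFin I.2) (fun I _ => ?_)
      (fun I _ J _ h => ?_) (fun f hf => ?_) (fun I _ => rfl)
    · exact mem_incr.2 (I.1.orderEmbOfFin I.2).strictMono
    · have := congrArg Set.range h
      rw [Finset.range_orderEmbOfFin, Finset.range_orderEmbOfFin] at this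
      exact Subtype.ext (Finset.coe_injective this)
    · rw [mem_incr] at hf
      refine ⟨⟨Finset.univ.image f, by
        rw [Finset.card_image_of_injective _ hf.injective, Finset.card_fin]⟩,
        Finset.mem_univ _, ?_⟩
      exact (Finset.orderEmbOfFin_unique _ (fun i => Finset.mem_image_of_mem f (Finset.mem_univ i))
        hf).symm
  rw [← key, sumMinors]
  exact Finset.sum_congr rfl fun I _ =>
    key fun g => (X.submatrix (I.1.orderEmbOfFin I.2) g).det

end SumIncr

/-! ### Row operations on minors. -/

section Minor

variable {ι R : Type*} [CommRing R] (K : Matrix ι ι R)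

/-- Append an index to a finite tuple of indices. -/
abbrev app {k : ℕ} (f : Fin k → ι) (r : ι) : Fin (k + 1) → ι := Fin.snoc (α := fun _ => ι) f r

/-- The minor of `K` with rows `f` and columns `g`. -/
def minor {k : ℕ} (f g : Fin k → ι) : R := (K.submatrix f g).det

variable {K}

theorem minor_comm (hK : ∀ i j, K i j = K j i) {k : ℕ} (f g : Fin k → ι) :
    minor K f g = minor K g f := by
  rw [minor, ← det_transpose, transpose_submatrix, minor]
  congr 2
  ext i j
  exact hK j i

/-- Rows r and κp differ only in column c, so linearity in the last row leaves a single cofactor as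
correction. -/
theorem minor_app_app {k : ℕ} {f g : Fin k → ι} {r p c : ι} {κ : R}
    (h : ∀ j, K r (g j) = κ * K p (g j)) :
    minor K (app f r) (app g c) =
      κ * minor K (app f p) (app g c) + (K r c - κ * K p c) * minor K f g := by
  have hdet : ∀ q, minor K (app f q) (app g c) =
      (∑ j : Fin k, (-1) ^ (k + (j : ℕ)) * K q (g j) *
        (K.submatrix f (app g c ∘ j.castSucc.succAbove)).det) + K q c * minor K f g := by
    intro q
    rw [minor, det_succ_row _ (Fin.last k), Fin.sum_univ_castSucc]
    have h1 : ∀ g' : Fin k → Fin (k + 1), ((K.submatrix (app f q) (app g c)).submatrix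
        (Fin.last k).succAbove g') = K.submatrix f (app g c ∘ g') := fun g' => by
      ext i j; simp
    have h2 : app g c ∘ (Fin.last k).succAbove = g := by ext i; simp
    simp only [h1, h2, submatrix_apply, Fin.snoc_last, Fin.snoc_castSucc, Fin.val_last,
      Fin.val_castSucc, ← two_mul, pow_mul, neg_one_sq, one_pow, one_mul, minor]
  rw [hdet r, hdet p, mul_add, Finset.mul_sum]
  have : ∀ j : Fin k, (-1) ^ (k + (j : ℕ)) * K r (g j) *
        (K.submatrix f (app g c ∘ j.castSucc.succAbove)).det =
      κ * ((-1) ^ (k + (j : ℕ)) * K p (g j) *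
        (K.submatrix f (app g c ∘ j.castSucc.succAbove)).det) := fun j => by rw [h]; ring
  simp only [this]
  ring

theorem minor_app_left {k : ℕ} {f : Fin k → ι} {g : Fin (k + 1) → ι} {r p : ι} {κ : R}
    (h : ∀ j, K r (g j) = κ * K p (g j)) :
    minor K (app f r) g = κ * minor K (app f p) g := by
  have hg : app (fun i => g (Fin.castSucc i)) (g (Fin.last k)) = g := Fin.snoc_init_self g
  rw [← hg, minor_app_app (fun j => h j.castSucc) (p := p) (κ := κ), h, sub_self, zero_mul,
    add_zero]

theorem minor_app_app_left_self {k : ℕ} {f : Fin k → ι} {g : Fin (k + 2) → ι} {r : ι} :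
    minor K (app (app f r) r) g = 0 := by
  refine det_zero_of_row_eq (i := (Fin.last k).castSucc) (j := Fin.last (k + 1))
    (Fin.castSucc_lt_last _).ne ?_
  ext j
  simp

theorem minor_app_app_left_swap {k : ℕ} {f : Fin k → ι} {g : Fin (k + 2) → ι} {r s : ι} :
    minor K (app (app f r) s) g = -minor K (app (app f s) r) g := by
  have := det_permute (Equiv.swap (Fin.last k).castSucc (Fin.last (k + 1)))
    (K.submatrix (app (app f s) r) g)
  rw [Equiv.Perm.sign_swap (Fin.castSucc_lt_last _).ne] at this
  rw [minor, minor, ← neg_one_mul]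
  convert this using 2
  · ext i j
    rw [submatrix_apply, submatrix_apply, submatrix_apply, id]
    congr 1
    refine Fin.lastCases ?_ (fun i => ?_) i
    · simp
    · refine Fin.lastCases ?_ (fun i => ?_) i
      · simp
      · rw [Equiv.swap_apply_of_ne_of_ne]
        · simp
        · simp
        · exact (Fin.castSucc_lt_last _).ne
  · simp

theorem minor_app_app_left_eq_zero {k : ℕ} {f : Fin k → ι} {g : Fin (k + 2) → ι} {r p : ι} {κ : R}
    (h : ∀ j, K r (g j) = κ * K p (g j)) : minor K (app (app f r) p) g = 0 := by
  rw [minor_app_app_left_swap, minor_app_left h, minor_app_app_left_self, mul_zero, neg_zero]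

end Minor

/-! ### Recursions for plain and bordered minor sums. -/

section Border

variable {ι R : Type*} [CommRing R] (K : Matrix ι ι R) (p : ι) {n : ℕ}

/-- The sum of the `k × k` minors of `K` along the sequence `a`. -/
noncomputable def minorSum (k : ℕ) (a : Fin n → ι) : R :=
  sumIncr k a fun f => sumIncr k a fun g => minor K f g

/-- The sum of the `(k + 1) × (k + 1)` minors of `K` along the sequence `a`, with last row `p`. -/
noncomputable def rowBorderedMinorSum (k : ℕ) (a : Fin n → ι) : R :=
  sumIncr k a fun f => sumIncr (k + 1) a fun g => minor K (app f p) g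

/-- The sum of the `(k + 1) × (k + 1)` minors of `K` along the sequence `a`, with last row and
last column `p`. -/
noncomputable def borderedMinorSum (k : ℕ) (a : Fin n → ι) : R :=
  sumIncr k a fun f => sumIncr k a fun g => minor K (app f p) (app g p)

theorem minorSum_zero (a : Fin n → ι) : minorSum K 0 a = 1 := by
  simp [minorSum, sumIncr_zero, minor]

theorem borderedMinorSum_zero (hp : K p p = 0) (a : Fin n → ι) :
    borderedMinorSum K p 0 a = 0 := by
  simp [borderedMinorSum, sumIncr_zero, minor, hp, Fin.snoc]

theorem minorSum_succ_of_isEmpty (k : ℕ) (a : Fin 0 → ι) : minorSum K (k + 1) a = 0 := by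
  rw [minorSum, sumIncr_succ_of_isEmpty]

theorem rowBorderedMinorSum_of_isEmpty (k : ℕ) (a : Fin 0 → ι) :
    rowBorderedMinorSum K p k a = 0 := by
  simp only [rowBorderedMinorSum, sumIncr_succ_of_isEmpty, sumIncr_eq_zero]

theorem borderedMinorSum_succ_of_isEmpty (k : ℕ) (a : Fin 0 → ι) :
    borderedMinorSum K p (k + 1) a = 0 := by
  rw [borderedMinorSum, sumIncr_succ_of_isEmpty]

variable {K} {p}

theorem rowBorderedMinorSum_eq_col (hK : ∀ i j, K i j = K j i) (k : ℕ) (a : Fin n → ι) :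
    rowBorderedMinorSum K p k a =
      sumIncr (k + 1) a fun f => sumIncr k a fun g => minor K f (app g p) := by
  rw [rowBorderedMinorSum, sumIncr_comm]
  simp only [minor_comm hK (app _ _)]

end Border

section BorderRec

variable {ι R : Type*} [CommRing R] {K : Matrix ι ι R} {p : ι} {n : ℕ}
  (hK : ∀ i j, K i j = K j i) (hp : K p p = 0) {a : Fin (n + 1) → ι} {κ : R}
  (h : ∀ i, K (a (Fin.last n)) (a i) = κ * K p (a i))

include hK hp h

/-- This is `minor_app_app` applied to the transpose; the corner correction loses its κ term because
the border corner is 0. -/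
theorem minor_border_col {k : ℕ} (f g : Fin k → Fin n) :
    minor K (app (fun i => a (f i).castSucc) p)
        (app (fun i => a (g i).castSucc) (a (Fin.last n))) =
      κ * minor K (app (fun i => a (f i).castSucc) p) (app (fun i => a (g i).castSucc) p) +
        K p (a (Fin.last n)) * minor K (fun i => a (f i).castSucc) (fun i => a (g i).castSucc) := by
  rw [minor_comm hK (app _ _), minor_app_app (p := p) (κ := κ) (fun j => h _), hp, mul_zero,
    sub_zero, hK _ p, minor_comm hK (fun i => a (g i).castSucc)]
  congr 2
  rw [minor_comm hK]

/-- Split by whether the new index is a row, a column, both or neither. The two mixed cases agree by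
symmetry; when it is both, its row and then its column are traded for the border. -/
theorem minorSum_succ (k : ℕ) :
    minorSum K (k + 1) a =
      minorSum K (k + 1) (fun i => a i.castSucc) +
      2 * κ * rowBorderedMinorSum K p k (fun i => a i.castSucc) +
      κ ^ 2 * borderedMinorSum K p k (fun i => a i.castSucc) +
      κ * K p (a (Fin.last n)) * minorSum K k (fun i => a i.castSucc) := by
  have h01 : (sumIncr (k + 1) (fun i => a i.castSucc) fun f => sumIncr k (fun i => a i.castSucc)
      fun g => minor K f (app g (a (Fin.last n)))) =
        κ * rowBorderedMinorSum K p k (fun i => a i.castSucc) := by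
    rw [rowBorderedMinorSum_eq_col hK, ← sumIncr_mul]
    refine sumIncr_congr fun f => ?_
    rw [← sumIncr_mul]
    refine sumIncr_congr fun g => ?_
    rw [minor_comm hK, minor_app_left (p := p) (κ := κ) (fun j => h _), minor_comm hK]
  have h10 : (sumIncr k (fun i => a i.castSucc) fun f => sumIncr (k + 1) (fun i => a i.castSucc)
      fun g => minor K (app f (a (Fin.last n))) g) =
        κ * rowBorderedMinorSum K p k (fun i => a i.castSucc) := by
    rw [rowBorderedMinorSum, ← sumIncr_mul]
    refine sumIncr_congr fun f => ?_
    rw [← sumIncr_mul]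
    refine sumIncr_congr fun g => ?_
    rw [minor_app_left (p := p) (κ := κ) (fun j => h _)]
  have h11 : (sumIncr k (fun i => a i.castSucc) fun f => sumIncr k (fun i => a i.castSucc)
      fun g => minor K (app f (a (Fin.last n))) (app g (a (Fin.last n)))) =
        κ ^ 2 * borderedMinorSum K p k (fun i => a i.castSucc) +
        κ * K p (a (Fin.last n)) * minorSum K k (fun i => a i.castSucc) := by
    rw [borderedMinorSum, minorSum, ← sumIncr_mul, ← sumIncr_mul, ← sumIncr_add]
    refine sumIncr_congr fun f => ?_
    rw [← sumIncr_mul, ← sumIncr_mul, ← sumIncr_add]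
    refine sumIncr_congr fun g => ?_
    rw [minor_app_app (p := p) (κ := κ) (fun j => h _), minor_border_col hK hp h, h]
    ring
  rw [minorSum]
  simp only [sumIncr_succ, sumIncr_add]
  rw [h01, h10, h11]
  simp only [minorSum]
  ring

theorem rowBorderedMinorSum_succ (k : ℕ) :
    rowBorderedMinorSum K p k a =
      rowBorderedMinorSum K p k (fun i => a i.castSucc) +
      κ * borderedMinorSum K p k (fun i => a i.castSucc) +
      K p (a (Fin.last n)) * minorSum K k (fun i => a i.castSucc) := by
  have h01 : (sumIncr k (fun i => a i.castSucc) fun f => sumIncr k (fun i => a i.castSucc)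
      fun g => minor K (app f p) (app g (a (Fin.last n)))) =
        κ * borderedMinorSum K p k (fun i => a i.castSucc) +
        K p (a (Fin.last n)) * minorSum K k (fun i => a i.castSucc) := by
    rw [borderedMinorSum, minorSum, ← sumIncr_mul, ← sumIncr_mul, ← sumIncr_add]
    refine sumIncr_congr fun f => ?_
    rw [← sumIncr_mul, ← sumIncr_mul, ← sumIncr_add]
    exact sumIncr_congr fun g => minor_border_col hK hp h f g
  have hsplit : rowBorderedMinorSum K p k a =
      sumIncr k (fun i => a i.castSucc) fun f => sumIncr (k + 1) a fun g =>
        minor K (app f p) g := by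
    rw [rowBorderedMinorSum]
    cases k with
    | zero => simp only [sumIncr_zero]
    | succ k =>
      -- Row sets containing the new index drop out: on columns from `a` its row is κ times the
      -- border row, which is also present.
      rw [sumIncr_succ, add_eq_left]
      rw [← sumIncr_eq_zero (k := k) (R := R) fun i : Fin n => a i.castSucc]
      refine sumIncr_congr fun f => ?_
      rw [← sumIncr_eq_zero (k := k + 2) (R := R) a]
      exact sumIncr_congr fun g => minor_app_app_left_eq_zero fun j => h _
  rw [hsplit]
  simp only [sumIncr_succ, sumIncr_add]
  rw [h01, rowBorderedMinorSum, add_assoc]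

theorem borderedMinorSum_succ (k : ℕ) :
    borderedMinorSum K p (k + 1) a =
      borderedMinorSum K p (k + 1) (fun i => a i.castSucc) -
      2 * K p (a (Fin.last n)) * rowBorderedMinorSum K p k (fun i => a i.castSucc) -
      κ * K p (a (Fin.last n)) * borderedMinorSum K p k (fun i => a i.castSucc) -
      K p (a (Fin.last n)) ^ 2 * minorSum K k (fun i => a i.castSucc) := by
  -- After a swap (the sign) the new row is last. Trading it for κ times the border row repeats that
  -- row, so only the corner term survives.
  have hrow : ∀ {k : ℕ} (f : Fin k → ι) (g : Fin (k + 1) → Fin (n + 1)),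
      minor K (app (app f (a (Fin.last n))) p) (app (fun i => a (g i)) p) =
        -K p (a (Fin.last n)) * minor K (app f p) (fun i => a (g i)) := fun f g => by
    rw [minor_app_app_left_swap, minor_app_app (p := p) (κ := κ) (fun j => h _),
      minor_app_app_left_self, hp, hK _ p]
    ring
  have h10 : (sumIncr k (fun i => a i.castSucc) fun f => sumIncr (k + 1) (fun i => a i.castSucc)
      fun g => minor K (app (app f (a (Fin.last n))) p) (app g p)) =
        -K p (a (Fin.last n)) * rowBorderedMinorSum K p k (fun i => a i.castSucc) := by
    rw [rowBorderedMinorSum, ← sumIncr_mul]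
    refine sumIncr_congr fun f => ?_
    rw [← sumIncr_mul]
    exact sumIncr_congr fun g => hrow _ _
  have h01 : (sumIncr (k + 1) (fun i => a i.castSucc) fun f => sumIncr k (fun i => a i.castSucc)
      fun g => minor K (app f p) (app (app g (a (Fin.last n))) p)) =
        -K p (a (Fin.last n)) * rowBorderedMinorSum K p k (fun i => a i.castSucc) := by
    rw [← h10, sumIncr_comm]
    exact sumIncr_congr fun g => sumIncr_congr fun f => minor_comm hK _ _
  have h11 : (sumIncr k (fun i => a i.castSucc) fun f => sumIncr k (fun i => a i.castSucc)
      fun g => minor K (app (app f (a (Fin.last n))) p) (app (app g (a (Fin.last n))) p)) =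
        -(κ * K p (a (Fin.last n))) * borderedMinorSum K p k (fun i => a i.castSucc) +
        -K p (a (Fin.last n)) ^ 2 * minorSum K k (fun i => a i.castSucc) := by
    rw [borderedMinorSum, minorSum, ← sumIncr_mul, ← sumIncr_mul, ← sumIncr_add]
    refine sumIncr_congr fun f => ?_
    rw [← sumIncr_mul, ← sumIncr_mul, ← sumIncr_add]
    refine sumIncr_congr fun g => ?_
    -- `hrow` needs all columns but the border to be values of `a`.
    have hg : app (fun i => a (g i).castSucc) (a (Fin.last n)) =
        fun i => a (app (fun i => (g i).castSucc) (Fin.last n) i) := by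
      funext i
      refine Fin.lastCases ?_ (fun i => ?_) i
      · simp
      · simp
    rw [hg, hrow, ← hg, minor_border_col hK hp h]
    ring
  rw [borderedMinorSum]
  simp only [sumIncr_succ, sumIncr_add]
  rw [h01, h10, h11]
  simp only [borderedMinorSum]
  ring

end BorderRec

/-! ### Time evolution and conservation. -/

/-- Left of the last peakon its contribution is a multiple of e^ξ, which can be absorbed into the
incoming coefficient `a` of the evolution lemma. -/
theorem wave_eq_snoc {n : ℕ} (x m : Fin (n + 1) → ℝ) {ξ : ℝ} (h : ξ ≤ x (Fin.last n)) :
    wave x m ξ = wave (fun i => x i.castSucc) (fun i => m i.castSucc) ξ +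
      m (Fin.last n) * Real.exp (-x (Fin.last n)) * Real.exp ξ := by
  rw [wave, Fin.sum_univ_castSucc, abs_of_nonpos (by linarith), mul_assoc, ← Real.exp_add, wave]
  ring_nf

theorem waveSlopeAvg_eq_snoc {n : ℕ} (x m : Fin (n + 1) → ℝ) {ξ : ℝ} (h : ξ < x (Fin.last n)) :
    waveSlopeAvg x m ξ = waveSlopeAvg (fun i => x i.castSucc) (fun i => m i.castSucc) ξ +
      m (Fin.last n) * Real.exp (-x (Fin.last n)) * Real.exp ξ := by
  rw [waveSlopeAvg, Fin.sum_univ_castSucc, abs_of_nonpos (by linarith),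
    Real.sign_of_neg (by linarith), mul_assoc _ (Real.exp _), ← Real.exp_add, waveSlopeAvg]
  ring_nf

theorem wave_last {n : ℕ} {x : Fin (n + 1) → ℝ} (m : Fin (n + 1) → ℝ) (hx : StrictMono x) :
    wave x m (x (Fin.last n)) =
      (∑ i : Fin n, m i.castSucc * Real.exp (x i.castSucc)) * Real.exp (-x (Fin.last n)) +
        m (Fin.last n) := by
  simp only [wave, Fin.sum_univ_castSucc, sub_self, abs_zero, neg_zero, Real.exp_zero, mul_one,
    Finset.sum_mul, mul_assoc, ← Real.exp_add]
  congr 1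
  refine Finset.sum_congr rfl fun i _ => ?_
  rw [abs_of_pos (sub_pos.2 (hx (Fin.castSucc_lt_last i)))]
  ring_nf

theorem waveSlopeAvg_last {n : ℕ} {x : Fin (n + 1) → ℝ} (m : Fin (n + 1) → ℝ)
    (hx : StrictMono x) :
    waveSlopeAvg x m (x (Fin.last n)) =
      -((∑ i : Fin n, m i.castSucc * Real.exp (x i.castSucc)) * Real.exp (-x (Fin.last n))) := by
  simp only [waveSlopeAvg, Fin.sum_univ_castSucc, sub_self, Real.sign_zero, mul_zero, zero_mul,
    add_zero, Finset.sum_mul, mul_assoc, ← Real.exp_add]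
  congr 1
  refine Finset.sum_congr rfl fun i _ => ?_
  have := sub_pos.2 (hx (Fin.castSucc_lt_last i))
  rw [abs_of_pos this, Real.sign_of_pos this]
  ring_nf

/-- The time evolution of the first column `(A, B, C)` of the total jump matrix of the peakons
`x_1 < ⋯ < x_n` when the peakons to their right contribute `a e^ξ` to the wave: the column
satisfies the linear system given by the time part of the Lax pair, on the right of `x_n`. -/
theorem hasDerivWithinAt_polyABC {n : ℕ} (l : ℝ) (hl : l ≠ 0) (J : Set ℝ) (t a : ℝ)
    (x m : ℝ → Fin n → ℝ) (ho : StrictMono (x t))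
    (hx : ∀ k, HasDerivWithinAt (fun s => x s k)
      ((wave (x t) (m t) (x t k) + a * Real.exp (x t k)) ^ 2) J t)
    (hm : ∀ k, HasDerivWithinAt (fun s => m s k)
      (-(m t k) * (wave (x t) (m t) (x t k) + a * Real.exp (x t k)) *
        (waveSlopeAvg (x t) (m t) (x t k) + a * Real.exp (x t k))) J t)
    (b : ℝ) (hb : b = ∑ i, m t i * Real.exp (x t i)) :
    HasDerivWithinAt (fun s => (polyA (x s) (m s)).eval l)
      (-2 * a * b * (polyA (x t) (m t)).eval l + 2 * a * (polyB (x t) (m t)).eval l +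
        2 * a ^ 2 * l * (polyC (x t) (m t)).eval l) J t ∧
    HasDerivWithinAt (fun s => (polyB (x s) (m s)).eval l)
      (-b / l * (polyA (x t) (m t)).eval l + 1 / l * (polyB (x t) (m t)).eval l +
        a * (polyC (x t) (m t)).eval l) J t ∧
    HasDerivWithinAt (fun s => (polyC (x s) (m s)).eval l)
      (-2 * b ^ 2 / l * (polyA (x t) (m t)).eval l + 2 * b / l * (polyB (x t) (m t)).eval l +
        2 * a * b * (polyC (x t) (m t)).eval l) J t := by
  induction n generalizing a b with
  | zero => subst hb; simp [hasDerivWithinAt_const]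
  | succ n ih =>
    have hlast := wave_last (m t) ho
    have hslope := waveSlopeAvg_last (m t) ho
    have hX := hx (Fin.last n)
    have hM := hm (Fin.last n)
    rw [Fin.sum_univ_castSucc] at hb
    rw [hlast] at hX hM
    rw [hslope] at hM
    -- The remaining peakons see the last one as part of the wave from the right, which is why `a`
    -- must be general in the induction.
    obtain ⟨hA, hB, hC⟩ := ih (a + m t (Fin.last n) * Real.exp (-x t (Fin.last n)))
      (fun s i => x s i.castSucc) (fun s i => m s i.castSucc)
      (fun i j h => ho (Fin.castSucc_lt_castSucc_iff.2 h))
      (fun k => by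
        have := hx k.castSucc
        rw [wave_eq_snoc _ _ (ho (Fin.castSucc_lt_last k)).le] at this
        convert this using 1; ring)
      (fun k => by
        have := hm k.castSucc
        rw [wave_eq_snoc _ _ (ho (Fin.castSucc_lt_last k)).le,
          waveSlopeAvg_eq_snoc _ _ (ho (Fin.castSucc_lt_last k))] at this
        convert this using 1; ring) _ rfl
    have hee : ∀ y : ℝ, Real.exp (-y) = (Real.exp y)⁻¹ := Real.exp_neg
    have he2 : ∀ y : ℝ, Real.exp (2 * y) = Real.exp y ^ 2 := fun y => by
      rw [pow_two, ← Real.exp_add]; ring_nf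
    have he3 : ∀ y : ℝ, Real.exp (-2 * y) = (Real.exp y)⁻¹ ^ 2 := fun y => by
      rw [← hee, pow_two, ← Real.exp_add]; ring_nf
    have hE := hX.exp
    have hE' := hE.inv (Real.exp_ne_zero _)
    simp only [polyA_succ, polyB_succ, polyC_succ, eval_add, eval_sub, eval_mul, eval_pow, eval_C,
      eval_X, eval_one, hee, he2, he3] at *
    have h0 := Real.exp_ne_zero (x t (Fin.last n))
    subst hb
    generalize (∑ i : Fin n, m t i.castSucc * Real.exp (x t i.castSucc)) = b at *
    refine ⟨?_, ?_, ?_⟩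
    · refine (((((hM.pow 2).mul_const l).const_sub 1).mul hA).sub
        ((((hM.const_mul 2).mul hE').mul_const l).mul hB)).sub
        ((((hM.pow 2).mul (hE'.pow 2)).mul_const (l ^ 2)).mul hC) |>.congr_deriv ?_
      simp only [Pi.pow_apply, Pi.mul_apply, Pi.inv_apply, Nat.add_one_sub_one, pow_one,
        Nat.cast_ofNat]
      generalize Real.exp (x t (Fin.last n)) = E at *
      field_simp
      ring
    · refine ((((hM.mul hE).mul hA).add hB).add (((hM.mul hE').mul_const l).mul hC))
        |>.congr_deriv ?_
      simp only [Pi.mul_apply, Pi.inv_apply]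
      generalize Real.exp (x t (Fin.last n)) = E at *
      field_simp
      ring
    · refine (((((hM.pow 2).mul (hE.pow 2)).mul hA).add (((hM.const_mul 2).mul hE).mul hB)).add
        ((((hM.pow 2).mul_const l).const_add 1).mul hC)) |>.congr_deriv ?_
      simp only [Pi.pow_apply, Pi.mul_apply, Nat.add_one_sub_one, pow_one,
        Nat.cast_ofNat]
      generalize Real.exp (x t (Fin.last n)) = E at *
      field_simp
      ring

theorem isConstantOfMotion_eval_polyA {n : ℕ} {l : ℝ} (hl : l ≠ 0) :
    IsConstantOfMotion (n := n) fun x m => (polyA x m).eval l := by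
  intro J hJ x m h s hs t ht
  have hd : ∀ r ∈ J, HasDerivWithinAt (fun s => (polyA (x s) (m s)).eval l) 0 J r := fun r hr => by
    -- With a = 0 every term in the derivative of A vanishes.
    have := (hasDerivWithinAt_polyABC l hl J r 0 x m (h.ordered r hr)
      (fun k => by simpa using h.position r hr k) (fun k => by simpa using h.momentum r hr k)
      _ rfl).1
    simpa using this
  have := hJ.convex.norm_image_sub_le_of_norm_hasDerivWithin_le (C := 0) hd (by simp) ht hs
  simpa [sub_eq_zero] using this

theorem isConstantOfMotion_H {n : ℕ} (k : ℕ) : IsConstantOfMotion (n := n) (H k) := by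
  intro J hJ x m h s hs t ht
  -- The evolution equations contain 1/λ, so λ = 0 is excluded; agreement at all other values still
  -- forces equality.
  have : polyA (x s) (m s) = polyA (x t) (m t) :=
    Polynomial.eq_of_infinite_eval_eq _ _ <|
      (Set.infinite_of_finite_compl (s := {l : ℝ | l ≠ 0}) (by simp [Set.compl_ofPred])).mono
        fun l hl => isConstantOfMotion_eval_polyA hl J hJ x m h s hs t ht
  simp only [H, this]

/-! ### Coefficients as sums of minors. -/

/-- The kernel `m_i m_j e^{-|x_i - x_j|}` on pairs (position, amplitude), bordered by the vector
`m_i e^{x_i}` at the extra index `none`. -/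
noncomputable def peakonKernel : Matrix (Option (ℝ × ℝ)) (Option (ℝ × ℝ)) ℝ
  | some a, some b => a.2 * b.2 * Real.exp (-|a.1 - b.1|)
  | some a, none => a.2 * Real.exp a.1
  | none, some b => b.2 * Real.exp b.1
  | none, none => 0

theorem peakonKernel_comm (a b : Option (ℝ × ℝ)) : peakonKernel a b = peakonKernel b a := by
  rcases a with _ | a <;> rcases b with _ | b <;> simp only [peakonKernel]
  rw [abs_sub_comm]
  ring

theorem peakonKernel_some_of_le {a b : ℝ × ℝ} (h : b.1 ≤ a.1) :
    peakonKernel (some a) (some b) = a.2 * Real.exp (-a.1) * peakonKernel none (some b) := by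
  rw [peakonKernel, peakonKernel, abs_of_nonneg (sub_nonneg.2 h), neg_sub, sub_eq_neg_add,
    Real.exp_add]
  ring

/-- The sequence of peakons `(x_k, m_k)` as indices of `peakonKernel`. -/
def peakons {n : ℕ} (x m : Fin n → ℝ) (i : Fin n) : Option (ℝ × ℝ) := some (x i, m i)

/-- The coefficients of `A`, `B` and `λ C` are sums of minors of `P E P`, without border or
bordered by `m_i e^{x_i}` on one side or on both. -/
theorem coeff_polyABC {n : ℕ} (x m : Fin n → ℝ) (hx : StrictMono x) (k : ℕ) :
    (-1) ^ k * (polyA x m).coeff k = minorSum peakonKernel k (peakons x m) ∧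
    (-1) ^ k * (polyB x m).coeff k = rowBorderedMinorSum peakonKernel none k (peakons x m) ∧
    (-1) ^ k * (X * polyC x m).coeff k = borderedMinorSum peakonKernel none k (peakons x m) := by
  induction n generalizing k with
  | zero =>
    cases k with
    | zero => simp [minorSum_zero, rowBorderedMinorSum_of_isEmpty,
        borderedMinorSum_zero peakonKernel none rfl]
    | succ k => simp [minorSum_succ_of_isEmpty, rowBorderedMinorSum_of_isEmpty,
        borderedMinorSum_succ_of_isEmpty, coeff_one]
  | succ n ih =>
    have hK := peakonKernel_comm
    have hp : peakonKernel none none = 0 := rfl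
    have h : ∀ i, peakonKernel (peakons x m (Fin.last n)) (peakons x m i) =
        m (Fin.last n) * Real.exp (-x (Fin.last n)) * peakonKernel none (peakons x m i) :=
      fun i => peakonKernel_some_of_le (hx.monotone (Fin.le_last i))
    have hν : peakonKernel none (peakons x m (Fin.last n)) =
      m (Fin.last n) * Real.exp (x (Fin.last n)) := rfl
    replace ih := fun k => ih (fun i => x i.castSucc) (fun i => m i.castSucc)
      (fun i j h => hx (Fin.castSucc_lt_castSucc_iff.2 h)) k
    have hpk : (fun i : Fin n => peakons x m i.castSucc) =
      peakons (fun i => x i.castSucc) (fun i => m i.castSucc) := rfl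
    have hexp : Real.exp (-x (Fin.last n)) * Real.exp (x (Fin.last n)) = 1 := by
      rw [← Real.exp_add]; simp
    have hexp2 : Real.exp (2 * x (Fin.last n)) = Real.exp (x (Fin.last n)) ^ 2 := by
      rw [← Real.exp_nat_mul]; norm_num
    have hexp3 : Real.exp (-2 * x (Fin.last n)) = Real.exp (-x (Fin.last n)) ^ 2 := by
      rw [← Real.exp_nat_mul]; push_cast; ring_nf
    obtain ⟨hA, hB, hC⟩ := ih k
    refine ⟨?_, ?_, ?_⟩
    · cases k with
      | zero => simpa [polyA_succ, minorSum_zero, coeff_zero_eq_eval_zero] using eval_zero_polyA _ _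
      | succ k =>
        rw [minorSum_succ hK hp h, hν, hpk, ← hA, ← (ih k).1, ← (ih k).2.1, ← (ih k).2.2]
        -- Regrouped so that C enters only through λC, whose coefficients are the doubly bordered
        -- sums.
        have : polyA x m = polyA (fun i => x i.castSucc) (fun i => m i.castSucc)
          - X * (C (m (Fin.last n) ^ 2) * polyA (fun i => x i.castSucc) (fun i => m i.castSucc)
            + C (2 * m (Fin.last n) * Real.exp (-x (Fin.last n))) *
              polyB (fun i => x i.castSucc) (fun i => m i.castSucc)
            + C (m (Fin.last n) ^ 2 * Real.exp (-2 * x (Fin.last n))) *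
              (X * polyC (fun i => x i.castSucc) (fun i => m i.castSucc))) := by
          rw [polyA_succ]; ring
        rw [this]
        simp only [coeff_sub, coeff_X_mul _ k, coeff_add, coeff_C_mul, hexp3]
        linear_combination (-(-1) ^ k * m (Fin.last n) ^ 2 *
          (polyA (fun i => x i.castSucc) (fun i => m i.castSucc)).coeff k) * hexp
    · rw [rowBorderedMinorSum_succ hK hp h, hν, hpk, ← hA, ← hB, ← hC]
      have : polyB x m = C (m (Fin.last n) * Real.exp (x (Fin.last n))) *
          polyA (fun i => x i.castSucc) (fun i => m i.castSucc)
        + polyB (fun i => x i.castSucc) (fun i => m i.castSucc)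
        + C (m (Fin.last n) * Real.exp (-x (Fin.last n))) *
          (X * polyC (fun i => x i.castSucc) (fun i => m i.castSucc)) := by
        rw [polyB_succ]; ring
      rw [this]
      simp only [coeff_add, coeff_C_mul]
      ring
    · cases k with
      | zero => simp [borderedMinorSum_zero, hp]
      | succ k =>
        rw [borderedMinorSum_succ hK hp h, hν, hpk, ← hC, ← (ih k).1, ← (ih k).2.1, ← (ih k).2.2]
        have : polyC x m = C (m (Fin.last n) ^ 2 * Real.exp (2 * x (Fin.last n))) *
            polyA (fun i => x i.castSucc) (fun i => m i.castSucc)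
          + C (2 * m (Fin.last n) * Real.exp (x (Fin.last n))) *
            polyB (fun i => x i.castSucc) (fun i => m i.castSucc)
          + polyC (fun i => x i.castSucc) (fun i => m i.castSucc)
          + C (m (Fin.last n) ^ 2) *
            (X * polyC (fun i => x i.castSucc) (fun i => m i.castSucc)) := by
          rw [polyC_succ]; ring
        rw [this]
        simp only [coeff_X_mul _ k, coeff_add, coeff_C_mul, hexp2]
        linear_combination ((-1) ^ k * m (Fin.last n) ^ 2 *
          (X * polyC (fun i => x i.castSucc) (fun i => m i.castSucc)).coeff k) * hexp

theorem H_eq_sumMinors {n : ℕ} {x : Fin n → ℝ} (m : Fin n → ℝ) (hx : StrictMono x) (k : ℕ) :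
    H k x m = sumMinors k (matP m * matE x * matP m) := by
  rw [H, (coeff_polyABC x m hx k).1, sumMinors_eq_sumIncr, minorSum]
  refine Finset.sum_congr rfl fun f _ => Finset.sum_congr rfl fun g _ => congrArg Matrix.det ?_
  ext i j
  exact (matPEP_apply x m (f i) (g j)).symm

theorem H_zero {n : ℕ} (x m : Fin n → ℝ) : H 0 x m = 1 := by
  rw [H, coeff_zero_eq_eval_zero, eval_zero_polyA, pow_zero, one_mul]

theorem natDegree_polyA_le {n : ℕ} (x m : Fin n → ℝ) (hx : StrictMono x) :
    (polyA x m).natDegree ≤ n := by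
  rw [polyA_eq_det x m hx]
  -- The degree bound for a linear matrix pencil, with constant term the identity.
  have := natDegree_det_X_add_C_le (-(matT n * matP m * matE x * matP m)) 1
  rw [Fintype.card_fin] at this
  rwa [Matrix.map_one _ C_0 C_1, Matrix.map_neg C (fun _ => C_neg), smul_neg,
    neg_add_eq_sub] at this

theorem polyA_eq_sum_H {n : ℕ} (x m : Fin n → ℝ) (hx : StrictMono x) :
    polyA x m = ∑ k ∈ Finset.range (n + 1), C (H k x m) * (-X) ^ k := by
  conv_lhs => rw [as_sum_range_C_mul_X_pow' _ (Nat.lt_succ_of_le (natDegree_polyA_le x m hx))]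
  refine Finset.sum_congr rfl fun k _ => ?_
  have h : (-1 : ℝ[X]) ^ k * (-1) ^ k = 1 := by rw [← mul_pow, neg_one_mul, neg_neg, one_pow]
  rw [H, neg_pow (X : ℝ[X]), C_mul, C_pow, C_neg, C_1]
  linear_combination (-(C ((polyA x m).coeff k) * X ^ k)) * h

end NovikovPeakon

theorem mainTheorem3 (n : ℕ) :
    (∀ k ∈ Finset.Icc 1 n,
      NovikovPeakon.IsConstantOfMotion (n := n) (NovikovPeakon.H k)) ∧
    ∀ x m : Fin n → ℝ, StrictMono x →
      NovikovPeakon.polyA x m =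
        ∑ k ∈ Finset.range (n + 1), C (NovikovPeakon.H k x m) * (-X) ^ k ∧
      NovikovPeakon.H 0 x m = 1 ∧
      NovikovPeakon.polyA x m =
        (1 - (X : ℝ[X]) • (NovikovPeakon.matT n * NovikovPeakon.matP m * NovikovPeakon.matE x *
          NovikovPeakon.matP m).map C).det ∧
      NovikovPeakon.matP m * NovikovPeakon.matE x * NovikovPeakon.matP m =
        Matrix.of (fun j k => m j * m k * Real.exp (-|x j - x k|)) ∧
      (NovikovPeakon.matP m * NovikovPeakon.matE x * NovikovPeakon.matP m).IsSymm ∧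
      ∀ k ∈ Finset.Icc 1 n,
        NovikovPeakon.H k x m =
          NovikovPeakon.sumMinors k
            (NovikovPeakon.matP m * NovikovPeakon.matE x * NovikovPeakon.matP m) := by
  refine ⟨fun k _ => NovikovPeakon.isConstantOfMotion_H k, fun x m hx =>
    ⟨NovikovPeakon.polyA_eq_sum_H x m hx, NovikovPeakon.H_zero x m,
      NovikovPeakon.polyA_eq_det x m hx, ?_, NovikovPeakon.matPEP_isSymm x m,
      fun k _ => NovikovPeakon.H_eq_sumMinors m hx k⟩⟩
  ext i j
  exact NovikovPeakon.matPEP_apply x m i j
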